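/- A numerical semigroup is a set $\Lambda\subseteq\mathbb{N}_0$ that contains $0$, is closed under addition and has finite complement. Its multiplicity is $\min(\Lambda\setminus\{0\})$, and its Frobenius number is $\min\{k\in\mathbb{N}_0 : k+\mathbb{N}_0\subseteq\Lambda\}-1$. For $q\ge 1$ let $c_q=\sqrt{\lfloor (q+2)^2/4\rfloor}$. **Theorem.** Fix an integer $q\ge 3$, and let the pair of positive integers $(f,m)$ vary subject to $(q-1)m<f<qm$. Then the number of numerical semigroups with multiplicity $m$ and Frobenius number $f$ is $$\left(c_q^{\alpha}\,c_{q-1}^{1-\alpha}\right)^{m+o(m)},\qquad \alpha=\frac fm-(q-1),$$ where $o(m)$ is as $m\to\infty$, uniformly in $f$. That is, there is a real function $E(f,m)$ such that the number equals $\left(c_q^{\alpha}c_{q-1}^{1-\alpha}\right)^{m+E(f,m)}$ for all such pairs $(f,m)$, and for every $\varepsilon>0$ there is $M$ (depending only on $q$ and $\varepsilon$) with $|E(f,m)|\le\varepsilon m$ for all such pairs with $m\ge M$. -/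

import Mathlib

/-- A numerical semigroup: a subset of `ℕ` that contains `0`, is closed under addition and has
finite complement. -/
structure NumericalSemigroup extends AddSubmonoid ℕ where
  finite_compl : (carrierᶜ).Finite

namespace NumericalSemigroup

/-- The multiplicity: the least nonzero element. -/
noncomputable def multiplicity (Λ : NumericalSemigroup) : ℕ :=
  sInf {x : ℕ | x ∈ Λ.carrier ∧ x ≠ 0}

/-- The conductor: the least `c` with `c + ℕ ⊆ Λ`. -/
noncomputable def conductor (Λ : NumericalSemigroup) : ℕ :=
  sInf {c : ℕ | ∀ n : ℕ, c + n ∈ Λ.carrier}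

/-- The Frobenius number: the conductor minus one, as an integer (it is `-1` for `Λ = ℕ`). -/
noncomputable def frobenius (Λ : NumericalSemigroup) : ℤ :=
  (Λ.conductor : ℤ) - 1

/-- The number of numerical semigroups with multiplicity `m` and Frobenius number `f`. -/
noncomputable def count (m f : ℕ) : ℕ :=
  Set.ncard {Λ : NumericalSemigroup | Λ.multiplicity = m ∧ Λ.frobenius = (f : ℤ)}

/-- The constant `c_q = √⌊(q + 2)² / 4⌋`; the division is that of `ℕ`, which rounds down. -/
noncomputable def growthConst (q : ℕ) : ℝ :=
  Real.sqrt (((q + 2) ^ 2 / 4 : ℕ) : ℝ)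

end NumericalSemigroup

section

open Finset

/-! Write f = (q-1)m + r with 0 < r < m. The m-th power of the claimed base is c_q^r c_{q-1}^(m-r),
the value at f of `mainTerm m`; the logarithm of the count has to agree with that of the main term
up to o(m).

Lower bound. A semigroup of multiplicity m is coded by its Kunz word: i + w_i m is the least element
congruent to i. Membership amounts to w_{i+j} ≤ w_i + w_j, with an extra +1 on the right when i + j
wraps around m. There is a box of words, between `wordLower` and `wordUpper`, in which every upper
bound is already at most the relevant sum of lower bounds, so every word of the box is a semigroup.
The size of the box is the main term up to a constant factor (`pow_mul_pow_le_count`).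

Upper bound. If g is a gap and x ≤ g, then x or g - x is a gap. Cut the line into windows of length
L and take the last window containing at least d gaps. Beyond its right end x₀ = km + ρ there are
few gaps, so they are cheap to list. Below x₀ the gap set is determined by the number of gaps in
each residue class: a word over {0, …, k+1} of length ρ and one over {0, …, k} of length m - ρ. The
d gaps x₀ - e just below x₀ force w_i + w_j ≥ p, with p = k+1 or k, whenever i + j + e is the length
of the word (`card_fiber_le`).

These constraints contain a bipartite graph of degree d on one side and at most d on the other. A
Finner type inequality shows that, as for the complete bipartite graph K_{d,d}, the best strategy is
a threshold t: labels at least p - t on one side and at least t on the other, giving (t+1)(p+1-t) ≤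
c_p² per pair, up to a factor (p+1)^(1/d). A single gap, d = 1, would not suffice: it allows
(p+1)(p+2)/2 labellings per pair.

Thus each fibre is bounded by roughly the main term at x₀ ≤ f + L, which exceeds the one at f by a
factor of at most 2^L. With d = J and L = ⌊m/J⌋ the total loss is exp(O(m/J) + O_J(log m)), and J is
arbitrary. -/

/-! ### Hölder's inequality and labellings of bipartite graphs -/

/-- Hölder's inequality for `d` functions with all exponents equal to `1 / d`. -/
theorem sum_prod_rpow_inv_le {α S : Type*} (A : Finset α) (X : Finset S) {d : ℕ}
    (hd : A.card = d) (f : α → S → ℝ) (hd0 : 0 < d) (hf : ∀ a s, 0 ≤ f a s) :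
    ∑ s ∈ X, ∏ a ∈ A, f a s ^ (1 / (d : ℝ)) ≤ ∏ a ∈ A, (∑ s ∈ X, f a s) ^ (1 / (d : ℝ)) := by
  have hdR : (0 : ℝ) < d := by exact_mod_cast hd0
  have hF : ∀ a, 0 ≤ ∑ s ∈ X, f a s := fun a => sum_nonneg fun s _ => hf a s
  by_cases hz : ∃ a ∈ A, ∑ s ∈ X, f a s = 0
  · obtain ⟨a, ha, h0⟩ := hz
    have h1 : ∀ s ∈ X, f a s = 0 := (sum_eq_zero_iff_of_nonneg fun s _ => hf a s).1 h0
    have h2 : ∑ s ∈ X, ∏ a ∈ A, f a s ^ (1 / (d : ℝ)) = 0 := by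
      refine sum_eq_zero fun s hs => prod_eq_zero ha ?_
      rw [h1 s hs, Real.zero_rpow (by positivity)]
    rw [h2]
    exact prod_nonneg fun a _ => Real.rpow_nonneg (hF a) _
  · push Not at hz
    have hpos : ∀ a ∈ A, 0 < ∑ s ∈ X, f a s := fun a ha => lt_of_le_of_ne (hF a) (hz a ha).symm
    set P := ∏ a ∈ A, (∑ s ∈ X, f a s) ^ (1 / (d : ℝ)) with hP
    have hPnn : 0 ≤ P := prod_nonneg fun a _ => Real.rpow_nonneg (hF a) _
    have key : ∀ s ∈ X, ∏ a ∈ A, f a s ^ (1 / (d : ℝ)) ≤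
        P * ∑ a ∈ A, (1 / (d : ℝ)) * (f a s / ∑ s ∈ X, f a s) := by
      intro s _
      have hg := Real.geom_mean_le_arith_mean_weighted A (fun _ => 1 / (d : ℝ))
        (fun a => f a s / ∑ s ∈ X, f a s) (fun _ _ => by positivity)
        (by rw [sum_const, hd, nsmul_eq_mul]; field_simp)
        (fun a _ => div_nonneg (hf a s) (hF a))
      calc ∏ a ∈ A, f a s ^ (1 / (d : ℝ))
          = P * ∏ a ∈ A, (f a s / ∑ s ∈ X, f a s) ^ (1 / (d : ℝ)) := by
            rw [hP, ← prod_mul_distrib]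
            refine prod_congr rfl fun a ha => ?_
            rw [← Real.mul_rpow (hF a) (div_nonneg (hf a s) (hF a)),
              mul_div_cancel₀ _ (hpos a ha).ne']
        _ ≤ _ := mul_le_mul_of_nonneg_left hg hPnn
    calc ∑ s ∈ X, ∏ a ∈ A, f a s ^ (1 / (d : ℝ))
        ≤ ∑ s ∈ X, P * ∑ a ∈ A, (1 / (d : ℝ)) * (f a s / ∑ s ∈ X, f a s) := sum_le_sum key
      _ = P * ∑ a ∈ A, (1 / (d : ℝ)) * ((∑ s ∈ X, f a s) / ∑ s ∈ X, f a s) := by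
          rw [← mul_sum, sum_comm]
          congr 1
          refine sum_congr rfl fun a _ => ?_
          rw [← mul_sum, sum_div]
      _ = P * ∑ a ∈ A, (1 / (d : ℝ)) := by
          congr 1
          refine sum_congr rfl fun a ha => ?_
          rw [div_self (hpos a ha).ne', mul_one]
      _ = P := by
          rw [sum_const, hd, nsmul_eq_mul]
          field_simp

/-- A Finner type inequality: on a bipartite graph in which every vertex of the side `Fin n` has
degree `d`, the sum over the labellings of that side factors over the other side. -/
theorem sum_prod_rpow_le_prod_of_degree {α S Θ : Type*} [Fintype α] [Fintype S] [Fintype Θ]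
    {d : ℕ} (hd0 : 0 < d) (h : Θ → S → ℝ) (hh : ∀ t s, 0 ≤ h t s) (n : ℕ)
    (N : α → Fin n → Prop) [∀ a b, Decidable (N a b)]
    (hN : ∀ b, (univ.filter fun a => N a b).card = d) (u : α → Θ → ℝ) (hu : ∀ a t, 0 ≤ u a t) :
    ∑ σ : Fin n → S, ∏ a, (∑ t, u a t * ∏ b, if N a b then h t (σ b) else 1) ^ (1 / (d : ℝ)) ≤
      ∏ a, (∑ t, u a t * ∏ b, if N a b then ∑ s, h t s else 1) ^ (1 / (d : ℝ)) := by
  induction n generalizing u with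
  | zero => simp
  | succ n ih =>
    have hite : ∀ (a : α) (b : Fin (n + 1)) (t : Θ) (s : S),
        0 ≤ if N a b then h t s else 1 := fun a b t s => by
      split_ifs
      exacts [hh t s, zero_le_one]
    have hsum : ∀ t, 0 ≤ ∑ s, h t s := fun t => sum_nonneg fun s _ => hh t s
    have step := ih (fun a b => N a b.succ) (fun b => hN b.succ)
      (fun a t => u a t * if N a 0 then ∑ s, h t s else 1)
      (fun a t => mul_nonneg (hu a t) (by split_ifs; exacts [hsum t, zero_le_one]))
    simp only [Fin.prod_univ_succ, ← mul_assoc]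
    refine le_trans ?_ step
    -- The label of vertex 0 is summed first. Only its `d` neighbours depend on it, so Hölder
    -- applies to exactly `d` factors, and the result is absorbed into the weight `u`.
    rw [← (Fin.consEquiv fun _ : Fin (n + 1) => S).sum_comp, Fintype.sum_prod_type, sum_comm]
    refine sum_le_sum fun τ _ => ?_
    simp only [Fin.consEquiv_apply, Fin.cons_zero, Fin.cons_succ]
    set R : α → Θ → ℝ := fun a t => ∏ b : Fin n, if N a b.succ then h t (τ b) else 1 with hR
    have hRnn : ∀ a t, 0 ≤ R a t := fun a t => prod_nonneg fun b _ => hite a b.succ t (τ b)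
    have hsplit : ∀ g : α → ℝ, ∏ a, g a =
        (∏ a ∈ univ.filter (fun a => N a 0), g a) * ∏ a ∈ univ.filter (fun a => ¬ N a 0), g a :=
      fun g => (prod_filter_mul_prod_filter_not _ _ _).symm
    have hol := sum_prod_rpow_inv_le (univ.filter fun a => N a 0) (univ : Finset S) (hN 0)
      (fun a s => ∑ t, u a t * h t s * R a t) hd0
      (fun a s => sum_nonneg fun t _ => mul_nonneg (mul_nonneg (hu a t) (hh t s)) (hRnn a t))
    rw [hsplit fun a => (∑ t, (u a t * if N a 0 then ∑ s, h t s else 1) * R a t) ^ (1 / (d : ℝ))]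
    have e1 : ∀ s, ∏ a, (∑ t, (u a t * if N a 0 then h t s else 1) * R a t) ^ (1 / (d : ℝ)) =
        (∏ a ∈ univ.filter (fun a => N a 0), (∑ t, u a t * h t s * R a t) ^ (1 / (d : ℝ))) *
          ∏ a ∈ univ.filter (fun a => ¬ N a 0), (∑ t, u a t * R a t) ^ (1 / (d : ℝ)) := by
      intro s
      rw [hsplit]
      congr 1
      · refine prod_congr rfl fun a ha => ?_
        simp [(mem_filter.1 ha).2]
      · refine prod_congr rfl fun a ha => ?_
        simp [(mem_filter.1 ha).2]
    rw [sum_congr rfl fun s _ => e1 s, ← sum_mul]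
    have e2 : ∏ a ∈ univ.filter (fun a => N a 0),
        (∑ t, (u a t * if N a 0 then ∑ s, h t s else 1) * R a t) ^ (1 / (d : ℝ)) =
        ∏ a ∈ univ.filter (fun a => N a 0), (∑ s, ∑ t, u a t * h t s * R a t) ^ (1 / (d : ℝ)) := by
      refine prod_congr rfl fun a ha => ?_
      rw [sum_comm]
      simp [(mem_filter.1 ha).2, mul_sum, sum_mul]
    have e3 : ∏ a ∈ univ.filter (fun a => ¬ N a 0),
        (∑ t, (u a t * if N a 0 then ∑ s, h t s else 1) * R a t) ^ (1 / (d : ℝ)) =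
        ∏ a ∈ univ.filter (fun a => ¬ N a 0), (∑ t, u a t * R a t) ^ (1 / (d : ℝ)) := by
      refine prod_congr rfl fun a ha => ?_
      simp [(mem_filter.1 ha).2]
    rw [e2, e3]
    refine mul_le_mul_of_nonneg_right hol (prod_nonneg fun a _ => Real.rpow_nonneg ?_ _)
    exact sum_nonneg fun t _ => mul_nonneg (hu a t) (hRnn a t)

theorem succ_mul_le_sq_div_four {p t : ℕ} (ht : t ≤ p) :
    (t + 1) * (p + 1 - t) ≤ (p + 2) ^ 2 / 4 := by
  rw [Nat.le_div_iff_mul_le (by norm_num)]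
  obtain ⟨k, rfl⟩ := Nat.exists_eq_add_of_le ht
  have : t + k + 1 - t = k + 1 := by omega
  rw [this]
  zify
  nlinarith [sq_nonneg ((t : ℤ) - k)]

/-- The number of pairs of labellings of the two sides of a bipartite graph, by labels in
`{0, …, p}` whose sum along each edge is at least `p`. -/
theorem card_bipartite_labellings_le {α : Type*} [Fintype α] [DecidableEq α] {d : ℕ}
    (hd0 : 0 < d) (p n : ℕ) (N : α → Fin n → Prop) [∀ a b, Decidable (N a b)]
    (hN : ∀ b, (univ.filter fun a => N a b).card = d)
    (hN' : ∀ a, (univ.filter fun b => N a b).card ≤ d) :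
    ((univ.filter fun z : (α → Fin (p + 1)) × (Fin n → Fin (p + 1)) =>
      ∀ a b, N a b → p ≤ (z.1 a : ℕ) + z.2 b).card : ℝ) ≤
      (((p : ℝ) + 1) ^ (1 / (d : ℝ)) * ((p + 2) ^ 2 / 4 : ℕ)) ^ Fintype.card α := by
  classical
  have hdR : (0 : ℝ) < d := by exact_mod_cast hd0
  set C : ℕ := (p + 2) ^ 2 / 4 with hC
  set h : Fin (p + 1) → Fin (p + 1) → ℝ := fun t s => if t ≤ s then 1 else 0 with hh
  have hcount : ∀ t : Fin (p + 1), ∑ s, h t s = ((p + 1 - t : ℕ) : ℝ) := by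
    intro t
    simp only [hh, sum_boole]
    congr 1
    rw [show (univ.filter fun s => t ≤ s) = Finset.Ici t by ext; simp, Fin.card_Ici]
  have hfib : ((univ.filter fun z : (α → Fin (p + 1)) × (Fin n → Fin (p + 1)) =>
      ∀ a b, N a b → p ≤ (z.1 a : ℕ) + z.2 b).card : ℝ) =
      ∑ y : Fin n → Fin (p + 1), ∏ a : α,
        ((univ.filter fun s : Fin (p + 1) => ∀ b, N a b → p ≤ (s : ℕ) + y b).card : ℝ) := by
    rw [card_filter, Fintype.sum_prod_type_right]
    push_cast
    refine sum_congr rfl fun y _ => ?_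
    rw [← Nat.cast_prod, ← Fintype.card_piFinset, sum_boole]
    congr 2
    ext x
    simp [Fintype.mem_piFinset]
  have hterm : ∀ (y : Fin n → Fin (p + 1)) (a : α),
      ((univ.filter fun s : Fin (p + 1) => ∀ b, N a b → p ≤ (s : ℕ) + y b).card : ℝ) ≤
      (∑ t : Fin (p + 1), ((t : ℝ) + 1) ^ d * ∏ b, if N a b then h t (y b) else 1)
        ^ (1 / (d : ℝ)) := by
    intro y a
    set F := univ.filter fun s : Fin (p + 1) => ∀ b, N a b → p ≤ (s : ℕ) + y b with hF
    have hne : F.Nonempty := ⟨Fin.last p, by simp [hF]⟩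
    set s0 := F.min' hne with hs0
    have hs0F : s0 ∈ F := F.min'_mem hne
    have hs0' := (mem_filter.1 hs0F).2
    have hcard : F.card ≤ p - s0 + 1 := by
      calc F.card ≤ (Finset.Ici s0).card :=
            card_le_card fun s hs => by simpa using F.min'_le s hs
        _ = p - s0 + 1 := by rw [Fin.card_Ici]; omega
    -- The threshold attached to `a`: its allowed labels are at least `p - t0`, so there are at most
    -- `t0 + 1` of them, and all its neighbours have label at least `t0`. The sum over `t` dominates
    -- its term at `t0`.
    set t0 : Fin (p + 1) := ⟨p - s0, by omega⟩ with ht0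
    have hone : ∏ b, (if N a b then h t0 (y b) else 1) = 1 := by
      refine prod_eq_one fun b _ => ?_
      split_ifs with hb
      · have := hs0' b hb
        have hle : t0 ≤ y b := by
          rw [Fin.le_def]
          simp only [ht0]
          omega
        simp [hh, hle]
      · rfl
    have hnn : ∀ t : Fin (p + 1), 0 ≤ ((t : ℝ) + 1) ^ d * ∏ b, if N a b then h t (y b) else 1 := by
      intro t
      refine mul_nonneg (by positivity) (prod_nonneg fun b _ => ?_)
      simp only [hh]
      split_ifs <;> norm_num
    have hge : ((t0 : ℝ) + 1) ^ d ≤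
        ∑ t : Fin (p + 1), ((t : ℝ) + 1) ^ d * ∏ b, if N a b then h t (y b) else 1 := by
      have := single_le_sum (fun t _ => hnn t) (mem_univ t0)
      rwa [hone, mul_one] at this
    calc (F.card : ℝ) ≤ (t0 : ℝ) + 1 := by
          have : F.card ≤ (t0 : ℕ) + 1 := hcard
          exact_mod_cast this
      _ = (((t0 : ℝ) + 1) ^ d) ^ (1 / (d : ℝ)) := by
          rw [one_div, Real.pow_rpow_inv_natCast (by positivity) hd0.ne']
      _ ≤ _ := Real.rpow_le_rpow (by positivity) hge (by positivity)
  rw [hfib]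
  refine (sum_le_sum fun y _ => prod_le_prod (fun a _ => Nat.cast_nonneg _)
    fun a _ => hterm y a).trans ?_
  refine (sum_prod_rpow_le_prod_of_degree hd0 h
    (fun t s => by simp only [hh]; split_ifs <;> norm_num) n N hN
    (fun _ t => ((t : ℝ) + 1) ^ d) (fun a t => by positivity)).trans ?_
  rw [← card_univ, ← prod_const]
  refine prod_le_prod (fun a _ => Real.rpow_nonneg (sum_nonneg fun t _ => ?_) _) fun a _ => ?_
  · refine mul_nonneg (by positivity) (prod_nonneg fun b _ => ?_)
    rw [hcount]
    split_ifs <;> positivity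
  · have hle : ∑ t : Fin (p + 1), ((t : ℝ) + 1) ^ d * (∏ b, if N a b then ∑ s, h t s else 1) ≤
        ((p : ℝ) + 1) * (C : ℝ) ^ d := by
      calc _ ≤ ∑ t : Fin (p + 1), (C : ℝ) ^ d := by
            refine sum_le_sum fun t _ => ?_
            rw [prod_ite, prod_const_one, mul_one, prod_const, hcount]
            -- The base is at least 1, so a vertex `a` of degree less than `d` may be treated as if
            -- it had degree `d`.
            have h1 : (1 : ℝ) ≤ ((p + 1 - t : ℕ) : ℝ) := by
              have : 1 ≤ p + 1 - (t : ℕ) := by omega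
              exact_mod_cast this
            calc _ ≤ ((t : ℝ) + 1) ^ d * ((p + 1 - t : ℕ) : ℝ) ^ d :=
                  mul_le_mul_of_nonneg_left (pow_le_pow_right₀ h1 (hN' a)) (by positivity)
              _ = ((((t : ℕ) + 1) * (p + 1 - t) : ℕ) : ℝ) ^ d := by
                  rw [← mul_pow]; push_cast; rfl
              _ ≤ (C : ℝ) ^ d := by
                  refine pow_le_pow_left₀ (by positivity) ?_ d
                  exact_mod_cast succ_mul_le_sq_div_four (Nat.lt_succ_iff.1 t.2)
        _ = _ := by simp
    calc _ ≤ (((p : ℝ) + 1) * (C : ℝ) ^ d) ^ (1 / (d : ℝ)) := by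
          refine Real.rpow_le_rpow (sum_nonneg fun t _ => ?_) hle (by positivity)
          refine mul_nonneg (by positivity) (prod_nonneg fun b _ => ?_)
          rw [hcount]
          split_ifs <;> positivity
      _ = _ := by
          rw [Real.mul_rpow (by positivity) (by positivity), one_div,
            Real.pow_rpow_inv_natCast (by positivity) hd0.ne']

/-! ### Words with reflected constraints -/

/-- The words `w` of length `n` over `{0, …, p}` with `w i + w j ≥ p` whenever
`i + j + e = n` for some `e` in a given set `D` of shifts. -/
def reflectedWords (p n : ℕ) (D : Finset ℕ) : Finset (Fin n → Fin (p + 1)) :=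
  univ.filter fun w =>
    ∀ e ∈ D, ∀ i j : Fin n, (i : ℕ) + j + e = n → p ≤ (w i : ℕ) + w j

theorem card_reflectedWords_le {d : ℕ} (hd0 : 0 < d) (p n L : ℕ) (D : Finset ℕ) (hD : D.card = d)
    (hDL : ∀ e ∈ D, 1 ≤ e ∧ e ≤ L) :
    ((reflectedWords p n D).card : ℝ) ≤
      ((p : ℝ) + 1) ^ L *
        (((p : ℝ) + 1) ^ (1 / (d : ℝ)) * ((p + 2) ^ 2 / 4 : ℕ)) ^ ((n + 1) / 2) := by
  classical
  set h := (n + 1) / 2 with hh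
  -- Positions below `h` form one side and the next `k` the other. Stopping at `n - L` keeps `n - (h
  -- + b) - e` free of truncation for every `e ≤ L`; it is below `h` because `e ≥ 1`. So each `b`
  -- has exactly `d` neighbours. The at most `L` remaining positions are left free.
  set k := n + 1 - L - h with hk
  have hLpos : 1 ≤ L := by
    obtain ⟨e, he⟩ := card_pos.1 (hD ▸ hd0)
    exact (hDL e he).1.trans (hDL e he).2
  have hkn : h + k ≤ n := by omega
  set r := n - h - k with hr
  have hrL : r ≤ L := by omega
  let N : Fin h → Fin k → Prop := fun a b => ∃ e ∈ D, (a : ℕ) + (h + b) + e = n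
  have hN : ∀ b, (univ.filter fun a => N a b).card = d := by
    intro b
    rw [← hD]
    refine (card_bij (fun e he => (⟨n - (h + b) - e, ?_⟩ : Fin h)) ?_ ?_ ?_).symm
    · have := (hDL e he).1
      omega
    · intro e he
      have := hDL e he
      simp only [mem_filter, mem_univ, true_and]
      refine ⟨e, he, ?_⟩
      simp only
      omega
    · intro e he e' he' hee
      have := hDL e he
      have := hDL e' he'
      simp only [Fin.mk.injEq] at hee
      omega
    · intro a ha
      obtain ⟨e, he, hae⟩ := (mem_filter.1 ha).2
      exact ⟨e, he, by ext; simp only; omega⟩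
  have hN' : ∀ a, (univ.filter fun b => N a b).card ≤ d := by
    intro a
    rw [← hD]
    refine card_le_card_of_injOn (fun b => n - h - a - b) ?_ ?_
    · intro b hb
      obtain ⟨e, he, hae⟩ := (mem_filter.1 hb).2
      have : n - h - a - b = e := by omega
      simpa [this] using he
    · intro b hb b' hb' hbb
      obtain ⟨e, he, hae⟩ := (mem_filter.1 hb).2
      obtain ⟨e', he', hae'⟩ := (mem_filter.1 hb').2
      ext
      simp only at hbb
      omega
  have main := card_bipartite_labellings_le hd0 p k N hN hN'
  rw [Fintype.card_fin] at main
  set Z := univ.filter fun z : (Fin h → Fin (p + 1)) × (Fin k → Fin (p + 1)) =>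
      ∀ a b, N a b → p ≤ (z.1 a : ℕ) + z.2 b with hZ
  have hinj : (reflectedWords p n D).card ≤
      ((univ : Finset (Fin r → Fin (p + 1))) ×ˢ Z).card := by
    refine card_le_card_of_injOn (fun w => (fun i => w ⟨h + k + i, by omega⟩,
      (fun a => w ⟨a, by omega⟩, fun b => w ⟨h + b, by omega⟩))) ?_ ?_
    · intro w hw
      have hw' := (mem_filter.1 hw).2
      simp only [coe_product, coe_univ, Set.mem_prod, Set.mem_univ, true_and, mem_coe, hZ,
        mem_filter, mem_univ]
      rintro a b ⟨e, he, hab⟩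
      exact hw' e he ⟨a, by omega⟩ ⟨h + b, by omega⟩ hab
    · intro w _ w' _ hww
      simp only [Prod.mk.injEq] at hww
      obtain ⟨h1, h2, h3⟩ := hww
      funext i
      by_cases hi : (i : ℕ) < h
      · exact congrFun h2 ⟨i, hi⟩
      · by_cases hi2 : (i : ℕ) < h + k
        · have := congrFun h3 ⟨i - h, by omega⟩
          have hi3 : h + ((i : ℕ) - h) = i := by omega
          simpa [hi3] using this
        · have := congrFun h1 ⟨i - (h + k), by omega⟩
          have hi3 : h + k + ((i : ℕ) - (h + k)) = i := by omega
          simpa [hi3] using this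
  have hcast : ((reflectedWords p n D).card : ℝ) ≤
      ((p : ℝ) + 1) ^ r * Z.card := by
    have h2 : ((univ : Finset (Fin r → Fin (p + 1))) ×ˢ Z).card = (p + 1) ^ r * Z.card := by
      simp [card_product]
    rw [h2] at hinj
    exact_mod_cast hinj
  refine hcast.trans (mul_le_mul ?_ (le_of_eq_of_le (by rw [hZ]; congr!) main) (by positivity) (by positivity))
  exact pow_le_pow_right₀ (by linarith [(Nat.cast_nonneg p : (0 : ℝ) ≤ p)]) hrL

/-! ### Gap sets, column counts and the last dense window -/

theorem mem_iff_lt_card_of_downward_closed {S : Finset ℕ}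
    (hdown : ∀ t, t + 1 ∈ S → t ∈ S) (t : ℕ) : t ∈ S ↔ t < S.card := by
  have hle : ∀ u s, s + u ∈ S → s ∈ S := by
    intro u
    induction u with
    | zero => exact fun s h => h
    | succ u ih => exact fun s h => ih s (hdown _ h)
  constructor
  · intro ht
    have : range (t + 1) ⊆ S := fun s hs =>
      hle (t - s) s (by rwa [Nat.add_sub_cancel' (Nat.lt_succ_iff.1 (mem_range.1 hs))])
    simpa using card_le_card this
  · intro ht
    by_contra hn
    have : S ⊆ range t := fun s hs => by
      rw [mem_range]
      by_contra hts
      exact hn (hle (s - t) t (by rwa [Nat.add_sub_cancel' (not_lt.1 hts)]))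
    have := card_le_card this
    rw [card_range] at this
    omega

theorem le_card_add_card_of_reflected {K : ℕ} {P Q : ℕ → Prop} [DecidablePred P] [DecidablePred Q]
    (h : ∀ t < K, P t ∨ Q (K - 1 - t)) :
    K ≤ ((range K).filter P).card + ((range K).filter Q).card := by
  calc K = (range K).card := (card_range K).symm
    _ ≤ ((range K).filter P ∪ ((range K).filter Q).image fun t => K - 1 - t).card := by
        refine card_le_card fun t ht => ?_
        have htK := mem_range.1 ht
        rcases h t htK with hp | hq
        · exact mem_union_left _ (mem_filter.2 ⟨ht, hp⟩)
        · refine mem_union_right _ (mem_image.2 ⟨K - 1 - t, mem_filter.2 ⟨?_, hq⟩, ?_⟩)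
          · rw [mem_range]; omega
          · omega
    _ ≤ _ := (card_union_le _ _).trans (Nat.add_le_add_left card_image_le _)

/-- The sets of size at most `K` in an `n`-element set number at most `(n + 1) ^ K`. -/
theorem card_filter_powerset_card_le {α : Type*} [DecidableEq α] (s : Finset α) (K : ℕ) :
    (s.powerset.filter fun W => W.card ≤ K).card ≤ (s.card + 1) ^ K := by
  induction K with
  | zero =>
    rw [pow_zero, card_le_one]
    intro a ha b hb
    have h1 := (mem_filter.1 ha).2
    have h2 := (mem_filter.1 hb).2
    rw [Nat.le_zero, card_eq_zero] at h1 h2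
    rw [h1, h2]
  | succ K ih =>
    set F := s.powerset.filter fun W => W.card ≤ K with hF
    have hsub : (s.powerset.filter fun W => W.card ≤ K + 1) ⊆
        F ∪ (s ×ˢ F).image fun z => insert z.1 z.2 := by
      intro W hW
      obtain ⟨hWs, hWc⟩ := mem_filter.1 hW
      rw [mem_powerset] at hWs
      by_cases hc : W.card ≤ K
      · exact mem_union_left _ (mem_filter.2 ⟨mem_powerset.2 hWs, hc⟩)
      · obtain ⟨x, hx⟩ : W.Nonempty := card_pos.1 (by omega)
        refine mem_union_right _ (mem_image.2 ⟨(x, W.erase x), mem_product.2 ⟨hWs hx, ?_⟩,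
          insert_erase hx⟩)
        refine mem_filter.2 ⟨mem_powerset.2 ((erase_subset _ _).trans hWs), ?_⟩
        rw [card_erase_of_mem hx]
        omega
    calc _ ≤ F.card + s.card * F.card := by
          refine (card_le_card hsub).trans ((card_union_le _ _).trans ?_)
          exact Nat.add_le_add_left (card_image_le.trans_eq (card_product _ _)) _
      _ = F.card * (s.card + 1) := by ring
      _ ≤ (s.card + 1) ^ K * (s.card + 1) := Nat.mul_le_mul_right _ ih
      _ = _ := (pow_succ _ _).symm

open Classical in
/-- A family of subsets of `{0, …, f}` which contains the gap set of every numerical semigroup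
of multiplicity `m` and Frobenius number `f`. -/
noncomputable def gapSets (m f : ℕ) : Finset (Finset ℕ) :=
  (range (f + 1)).powerset.filter fun G =>
    (∀ g ∈ G, ∀ x ≤ g, x ∈ G ∨ g - x ∈ G) ∧ (∀ x, x + m ∈ G → x ∈ G) ∧
      ∀ x, 0 < x → x < m → x ∈ G

theorem mem_gapSets {m f : ℕ} {G : Finset ℕ} : G ∈ gapSets m f ↔ G ⊆ range (f + 1) ∧
    (∀ g ∈ G, ∀ x ≤ g, x ∈ G ∨ g - x ∈ G) ∧ (∀ x, x + m ∈ G → x ∈ G) ∧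
      ∀ x, 0 < x → x < m → x ∈ G := by
  simp [gapSets]

/-- The number of `t < K` for which `i + t m` lies in `G`. -/
def columnCount (m K : ℕ) (G : Finset ℕ) (i : ℕ) : ℕ :=
  ((range K).filter fun t => i + t * m ∈ G).card

theorem columnCount_lt_succ (m K : ℕ) (G : Finset ℕ) (i : ℕ) : columnCount m K G i < K + 1 :=
  Nat.lt_succ_iff.2 ((card_filter_le _ _).trans_eq (card_range K))

/-- Gaps in a residue class form an initial segment, since `m` belongs to the semigroup; a column is
therefore determined by its count. -/
theorem mem_iff_lt_columnCount {m K t i : ℕ} {G : Finset ℕ} (hG : ∀ x, x + m ∈ G → x ∈ G)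
    (ht : t < K) : i + t * m ∈ G ↔ t < columnCount m K G i := by
  have h := mem_iff_lt_card_of_downward_closed (S := (range K).filter fun t => i + t * m ∈ G)
    (fun s hs => by
      obtain ⟨h1, h2⟩ := mem_filter.1 hs
      refine mem_filter.2 ⟨mem_range.2 (by have := mem_range.1 h1; omega), hG _ ?_⟩
      convert h2 using 1
      ring) t
  rw [columnCount, ← h, mem_filter, mem_range]
  exact ⟨fun hh => ⟨ht, hh⟩, fun hh => hh.2⟩

/-- For every `t < K` one has `g = (i + t m) + (j + (K - 1 - t) m)`, so the gap `g` puts a gap in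
column `i` at height `t` or in column `j` at height `K - 1 - t`. -/
theorem le_columnCount_add_columnCount {m K i j g : ℕ} {G : Finset ℕ}
    (hG : ∀ g ∈ G, ∀ x ≤ g, x ∈ G ∨ g - x ∈ G) (hg : g ∈ G) (hgij : g + m = K * m + i + j) :
    K ≤ columnCount m K G i + columnCount m K G j := by
  refine le_card_add_card_of_reflected fun t ht => ?_
  obtain ⟨u, rfl⟩ : ∃ u, K = u + t + 1 := ⟨K - 1 - t, by omega⟩
  have h1 : u + t + 1 - 1 - t = u := by omega
  have h2 : g = (i + t * m) + (j + u * m) := by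
    have : (u + t + 1) * m = u * m + t * m + m := by ring
    omega
  rw [h1]
  have := hG g hg (i + t * m) (by omega)
  rwa [h2, Nat.add_sub_cancel_left] at this

-- Below `k m + ρ` the residues less than `ρ` have `k + 1` rows and the others `k`. The column
-- counts recover this part of `G`, and `W` is the rest, so the map to pairs of words is injective.
open Classical in
theorem card_fiber_le {m f k ρ : ℕ} (hm : 0 < m) (hρ : ρ ≤ m) (D W : Finset ℕ) :
    ((gapSets m f).filter fun G => (∀ e ∈ D, e ≤ k * m + ρ ∧ k * m + ρ - e ∈ G) ∧
      G.filter (fun x => k * m + ρ ≤ x) = W).card ≤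
      (reflectedWords (k + 1) ρ D).card * (reflectedWords k (m - ρ) D).card := by
  rw [← card_product]
  refine card_le_card_of_injOn (fun G =>
    (fun i => ⟨columnCount m (k + 1) G i, columnCount_lt_succ _ _ _ _⟩,
      fun i => ⟨columnCount m k G (ρ + i), columnCount_lt_succ _ _ _ _⟩)) ?_ ?_
  · intro G hG
    obtain ⟨hG, hD, -⟩ := mem_filter.1 hG
    obtain ⟨-, h1, h2, -⟩ := mem_gapSets.1 hG
    rw [mem_coe, mem_product]
    constructor
    · simp only [reflectedWords, mem_filter, mem_univ, true_and]
      intro e he i j hij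
      refine le_columnCount_add_columnCount h1 (hD e he).2 ?_
      have : (k + 1) * m = k * m + m := by ring
      omega
    · simp only [reflectedWords, mem_filter, mem_univ, true_and]
      intro e he i j hij
      refine le_columnCount_add_columnCount h1 (hD e he).2 ?_
      have := (hD e he).1
      omega
  · intro G hG G' hG' hGG
    obtain ⟨hG, -, hW⟩ := mem_filter.1 hG
    obtain ⟨hG', -, hW'⟩ := mem_filter.1 hG'
    obtain ⟨-, -, h2, -⟩ := mem_gapSets.1 hG
    obtain ⟨-, -, h2', -⟩ := mem_gapSets.1 hG'
    simp only [Prod.mk.injEq] at hGG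
    obtain ⟨e1, e2⟩ := hGG
    ext x
    by_cases hx : k * m + ρ ≤ x
    · have : x ∈ G.filter (fun x => k * m + ρ ≤ x) ↔ x ∈ G'.filter (fun x => k * m + ρ ≤ x) := by
        rw [hW, hW']
      simpa [hx] using this
    · have hxm : x = x % m + x / m * m := (Nat.mod_add_div' x m).symm
      have hlt := Nat.mod_lt x hm
      by_cases hr : x % m < ρ
      · have hk : x / m < k + 1 := by
          rw [Nat.div_lt_iff_lt_mul hm]
          have : (k + 1) * m = k * m + m := by ring
          omega
        have := congrArg Fin.val (congrFun e1 ⟨x % m, hr⟩)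
        simp only at this
        rw [hxm, mem_iff_lt_columnCount h2 hk, mem_iff_lt_columnCount h2' hk, this]
      · have hk : x / m < k := by
          by_contra hcon
          have := Nat.mul_le_mul_right m (not_lt.1 hcon)
          omega
        have := congrArg Fin.val (congrFun e2 ⟨x % m - ρ, by omega⟩)
        simp only at this
        rw [Nat.add_sub_cancel' (not_lt.1 hr)] at this
        rw [hxm, mem_iff_lt_columnCount h2 hk, mem_iff_lt_columnCount h2' hk, this]

/-- Every gap set has a last window `[a L, (a + 1) L)` with at least `d` elements. -/
theorem exists_last_window {m f d L : ℕ} (hdL : d < L) (hLm : L ≤ m) (hd0 : 0 < d)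
    {G : Finset ℕ} (hG : G ∈ gapSets m f) :
    ∃ a ∈ range (f / L + 1), ∃ D ∈ (Icc 1 L).powersetCard d,
      (∀ e ∈ D, e ≤ (a + 1) * L ∧ (a + 1) * L - e ∈ G) ∧
      (G.filter fun x => (a + 1) * L ≤ x).card ≤ d * (f / L + 1) := by
  obtain ⟨hGf, -, -, h3⟩ := mem_gapSets.1 hG
  have hL : 0 < L := by omega
  set A := (range (f / L + 1)).filter fun a => d ≤ (G.filter fun x => x / L = a).card with hA
  have h0 : 0 ∈ A := by
    refine mem_filter.2 ⟨by simp, ?_⟩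
    -- Since `L ≤ m`, the first window contains the gaps 1, …, `L - 1`, and `d < L` makes it dense;
    -- hence a last dense window exists.
    have hsub : Ico 1 L ⊆ G.filter fun x => x / L = 0 := by
      intro x hx
      rw [mem_Ico] at hx
      exact mem_filter.2 ⟨h3 x (by omega) (by omega), Nat.div_eq_of_lt hx.2⟩
    have := card_le_card hsub
    rw [Nat.card_Ico] at this
    omega
  set a := A.max' ⟨0, h0⟩ with ha
  have haA : a ∈ A := A.max'_mem _
  obtain ⟨haf, had⟩ := mem_filter.1 haA
  refine ⟨a, haf, ?_⟩
  obtain ⟨T, hTs, hTc⟩ := exists_subset_card_eq had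
  have hT : ∀ x ∈ T, x ∈ G ∧ a * L ≤ x ∧ x < (a + 1) * L := by
    intro x hx
    obtain ⟨hxG, hxa⟩ := mem_filter.1 (hTs hx)
    exact ⟨hxG, by rw [← hxa]; exact Nat.div_mul_le_self x L,
      by rw [← Nat.div_lt_iff_lt_mul hL]; omega⟩
  have haL : (a + 1) * L = a * L + L := by ring
  refine ⟨T.image fun x => (a + 1) * L - x, ?_, ?_, ?_⟩
  · rw [mem_powersetCard]
    constructor
    · intro e he
      obtain ⟨x, hx, rfl⟩ := mem_image.1 he
      have := hT x hx
      rw [mem_Icc]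
      omega
    · rw [card_image_of_injOn, hTc]
      intro x hx y hy hxy
      have := hT x hx
      have := hT y hy
      simp only at hxy
      omega
  · intro e he
    obtain ⟨x, hx, rfl⟩ := mem_image.1 he
    obtain ⟨hxG, -, hx2⟩ := hT x hx
    refine ⟨Nat.sub_le _ _, ?_⟩
    rwa [Nat.sub_sub_self hx2.le]
  · have := card_le_mul_card_image_of_maps_to (s := G.filter fun x => (a + 1) * L ≤ x)
      (t := range (f / L + 1)) (f := fun x => x / L) (fun x hx => ?_) d (fun b hb => ?_)
    · simpa using this
    · have := mem_range.1 (hGf (mem_filter.1 hx).1)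
      rw [mem_range, Nat.lt_succ_iff]
      exact Nat.div_le_div_right (by omega)
    -- Windows up to `a` lie below the cut and contribute nothing; a later window with more than `d`
    -- gaps would contradict the maximality of `a`.
    · by_cases hba : b ≤ a
      · have : ((G.filter fun x => (a + 1) * L ≤ x).filter fun x => x / L = b) = ∅ := by
          refine filter_eq_empty_iff.2 fun x hx hxb => ?_
          have h1 := (mem_filter.1 hx).2
          rw [← Nat.le_div_iff_mul_le hL] at h1
          omega
        rw [this]
        simp
      · by_contra hcon
        have hbA : b ∈ A := by
          refine mem_filter.2 ⟨hb, (not_le.1 hcon).le.trans (card_le_card ?_)⟩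
          exact filter_subset_filter _ (filter_subset _ _)
        exact hba (A.le_max' b hbA)

/-- Union bound over the window `a`, the shifts `D` of `d` gaps in it, and the sparse set `W` of
gaps beyond it; `X` bounds each fibre. -/
theorem card_gapSets_le {m f d L : ℕ} (hdL : d < L) (hLm : L ≤ m) (hd0 : 0 < d) {X : ℝ}
    (hX : ∀ k ρ : ℕ, ρ < m → k * m + ρ ≤ f + L → ∀ D ∈ (Icc 1 L).powersetCard d,
      ((reflectedWords (k + 1) ρ D).card : ℝ) * (reflectedWords k (m - ρ) D).card ≤ X) :
    ((gapSets m f).card : ℝ) ≤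
      ((f / L + 1 : ℕ) : ℝ) * ((L : ℝ) + 1) ^ d * ((f : ℝ) + 2) ^ (d * (f / L + 1)) * X := by
  classical
  have hL : 0 < L := by omega
  have hm : 0 < m := by omega
  set K := d * (f / L + 1) with hK
  set I := range (f / L + 1) ×ˢ ((Icc 1 L).powersetCard d ×ˢ
    (range (f + 1)).powerset.filter fun W => W.card ≤ K) with hI
  let F : ℕ × Finset ℕ × Finset ℕ → Finset (Finset ℕ) := fun z =>
    (gapSets m f).filter fun G => (∀ e ∈ z.2.1, e ≤ (z.1 + 1) * L ∧ (z.1 + 1) * L - e ∈ G) ∧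
      G.filter (fun x => (z.1 + 1) * L ≤ x) = z.2.2
  have hcover : gapSets m f ⊆ I.biUnion F := by
    intro G hG
    obtain ⟨a, ha, D, hD, h1, h2⟩ := exists_last_window hdL hLm hd0 hG
    refine mem_biUnion.2 ⟨(a, D, G.filter fun x => (a + 1) * L ≤ x), ?_, ?_⟩
    · refine mem_product.2 ⟨ha, mem_product.2 ⟨hD, mem_filter.2 ⟨mem_powerset.2 ?_, h2⟩⟩⟩
      exact (filter_subset _ _).trans (mem_gapSets.1 hG).1
    · exact mem_filter.2 ⟨hG, h1, rfl⟩
  have hfib : ∀ z ∈ I, ((F z).card : ℝ) ≤ X := by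
    rintro ⟨a, D, W⟩ hz
    obtain ⟨ha, hz⟩ := mem_product.1 hz
    obtain ⟨hD, -⟩ := mem_product.1 hz
    have haf : a * L ≤ f := (Nat.le_div_iff_mul_le hL).1 (Nat.lt_succ_iff.1 (mem_range.1 ha))
    have hdm : (a + 1) * L / m * m + (a + 1) * L % m = (a + 1) * L := Nat.div_add_mod' _ _
    have haL : (a + 1) * L = a * L + L := by ring
    have hlt := Nat.mod_lt ((a + 1) * L) hm
    have h1 := card_fiber_le (f := f) (k := (a + 1) * L / m) hm hlt.le D W
    rw [hdm] at h1
    refine le_trans ?_ (hX _ _ hlt (by rw [hdm]; omega) D hD)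
    rw [← Nat.cast_mul]
    exact Nat.cast_le.2 h1
  have hX0 : 0 ≤ X := by
    obtain ⟨D, hD⟩ : ((Icc 1 L).powersetCard d).Nonempty := by
      rw [powersetCard_nonempty, Nat.card_Icc]
      omega
    exact le_trans (by positivity) (hX 0 0 hm (by omega) D hD)
  have hIc : (I.card : ℝ) ≤
      ((f / L + 1 : ℕ) : ℝ) * (((L : ℝ) + 1) ^ d * ((f : ℝ) + 2) ^ K) := by
    have h1 : ((Icc 1 L).powersetCard d).card ≤ (L + 1) ^ d := by
      rw [card_powersetCard, Nat.card_Icc]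
      exact (Nat.choose_le_pow _ _).trans (Nat.pow_le_pow_left (by omega) _)
    have h2 := card_filter_powerset_card_le (range (f + 1)) K
    rw [card_range] at h2
    have : I.card ≤ (f / L + 1) * ((L + 1) ^ d * (f + 2) ^ K) := by
      rw [hI, card_product, card_product, card_range]
      exact Nat.mul_le_mul_left _ (Nat.mul_le_mul h1 h2)
    exact_mod_cast this
  calc ((gapSets m f).card : ℝ) ≤ ((I.biUnion F).card : ℝ) := by exact_mod_cast card_le_card hcover
    _ ≤ ((∑ z ∈ I, (F z).card : ℕ) : ℝ) := by exact_mod_cast card_biUnion_le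
    _ ≤ ∑ _z ∈ I, X := by push_cast; exact sum_le_sum hfib
    _ = I.card * X := by rw [sum_const, nsmul_eq_mul]
    _ ≤ _ := by
      rw [mul_assoc (((f / L + 1 : ℕ) : ℝ))]
      exact mul_le_mul_of_nonneg_right hIc hX0

/-! ### From semigroups to gap sets -/

namespace NumericalSemigroup

theorem mem_of_conductor_le (Λ : NumericalSemigroup) {x : ℕ} (hx : Λ.conductor ≤ x) :
    x ∈ Λ.carrier := by
  have hne : {c : ℕ | ∀ n : ℕ, c + n ∈ Λ.carrier}.Nonempty := by
    obtain ⟨b, hb⟩ := Λ.finite_compl.bddAbove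
    refine ⟨b + 1, fun n => ?_⟩
    by_contra hn
    have := hb hn
    omega
  have := Nat.sInf_mem hne (x - Λ.conductor)
  rw [conductor] at hx this
  rwa [Nat.add_sub_cancel' hx] at this

open Classical in
theorem gaps_mem_gapSets {m f : ℕ} {Λ : NumericalSemigroup}
    (hΛm : Λ.multiplicity = m) (hΛf : Λ.frobenius = (f : ℤ)) :
    ((range (f + 1)).filter fun x => x ∉ Λ.carrier) ∈ gapSets m f ∧
      ∀ x, x ∈ Λ.carrier ↔ x ∉ (range (f + 1)).filter fun x => x ∉ Λ.carrier := by
  have hc : Λ.conductor = f + 1 := by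
    rw [frobenius] at hΛf
    omega
  have hlt : ∀ x, x ∉ Λ.carrier → x < f + 1 := by
    intro x hx
    by_contra hn
    exact hx (Λ.mem_of_conductor_le (by omega))
  have hmem : ∀ x, x ∈ ((range (f + 1)).filter fun x => x ∉ Λ.carrier) ↔ x ∉ Λ.carrier := by
    intro x
    rw [mem_filter, mem_range]
    exact ⟨fun h => h.2, fun h => ⟨hlt x h, h⟩⟩
  have hmΛ : m ∈ Λ.carrier := by
    have hne : {x : ℕ | x ∈ Λ.carrier ∧ x ≠ 0}.Nonempty :=
      ⟨f + 1, Λ.mem_of_conductor_le hc.le, by omega⟩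
    have := (Nat.sInf_mem hne).1
    rwa [← multiplicity, hΛm] at this
  refine ⟨mem_gapSets.2 ⟨filter_subset _ _, ?_, ?_, ?_⟩, fun x => by rw [hmem, not_not]⟩
  · intro g hg x hx
    rw [hmem] at hg ⊢
    rw [hmem]
    by_contra! hcon
    have := Λ.add_mem' hcon.1 hcon.2
    rw [Nat.add_sub_cancel' hx] at this
    exact hg this
  · intro x hx
    rw [hmem] at hx ⊢
    exact fun h => hx (Λ.add_mem' h hmΛ)
  · intro x hx0 hxm
    rw [hmem]
    intro hx
    rw [← hΛm, multiplicity] at hxm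
    exact Nat.notMem_of_lt_sInf hxm ⟨hx, by omega⟩

open Classical in
theorem injOn_gaps {m f : ℕ} :
    Set.InjOn (fun Λ : NumericalSemigroup => (range (f + 1)).filter fun x => x ∉ Λ.carrier)
      {Λ : NumericalSemigroup | Λ.multiplicity = m ∧ Λ.frobenius = (f : ℤ)} := by
  rintro Λ ⟨h1, h2⟩ Λ' ⟨h1', h2'⟩ h
  have hcar : Λ.carrier = Λ'.carrier := by
    ext x
    rw [(gaps_mem_gapSets h1 h2).2, (gaps_mem_gapSets h1' h2').2]
    exact not_congr (by rw [show ((range (f + 1)).filter fun x => x ∉ Λ.carrier) =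
      (range (f + 1)).filter fun x => x ∉ Λ'.carrier from h])
  obtain ⟨M, hM⟩ := Λ
  obtain ⟨M', hM'⟩ := Λ'
  have : M = M' := SetLike.coe_injective hcar
  subst this
  rfl

theorem finite_setOf_multiplicity_frobenius {m f : ℕ} :
    {Λ : NumericalSemigroup | Λ.multiplicity = m ∧ Λ.frobenius = (f : ℤ)}.Finite := by
  classical
  exact Set.Finite.of_injOn (t := (gapSets m f : Set (Finset ℕ)))
    (fun Λ hΛ => (gaps_mem_gapSets hΛ.1 hΛ.2).1) (injOn_gaps) (finite_toSet _)

theorem count_le_card_gapSets {m f : ℕ} : count m f ≤ (gapSets m f).card := by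
  classical
  rw [count, ← Set.ncard_coe_finset]
  exact Set.ncard_le_ncard_of_injOn _ (fun Λ hΛ => (gaps_mem_gapSets hΛ.1 hΛ.2).1)
    (injOn_gaps) (finite_toSet _)

/-! ### Lower bound: a box of Kunz words -/

/-- The numerical semigroup whose least element in the class of `i` modulo `m` is `i + w i * m`. -/
def ofWord (m q : ℕ) (w : ℕ → ℕ) (hm : 0 < m) (h0 : w 0 = 0) (hq : ∀ i < m, w i ≤ q)
    (h1 : ∀ i j, i + j < m → w (i + j) ≤ w i + w j)
    (h2 : ∀ i j, i < m → j < m → m ≤ i + j → w (i + j - m) ≤ w i + w j + 1) :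
    NumericalSemigroup where
  carrier := {x | w (x % m) ≤ x / m}
  zero_mem' := by simp [h0]
  add_mem' := by
    intro x y hx hy
    simp only [Set.mem_ofPred_eq] at hx hy ⊢
    have hxm := Nat.mod_lt x hm
    have hym := Nat.mod_lt y hm
    rw [Nat.add_div hm, Nat.add_mod]
    by_cases hc : m ≤ x % m + y % m
    · have h := h2 _ _ hxm hym hc
      rw [Nat.mod_eq_sub_mod hc, Nat.mod_eq_of_lt (by omega), if_pos hc]
      omega
    · have h := h1 _ _ (not_le.1 hc)
      rw [Nat.mod_eq_of_lt (not_le.1 hc), if_neg hc]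
      omega
  finite_compl := by
    refine (Set.finite_lt_nat (q * m)).subset fun x hx => ?_
    by_contra hn
    refine hx (?_ : w (x % m) ≤ x / m)
    exact (hq _ (Nat.mod_lt x hm)).trans ((Nat.le_div_iff_mul_le hm).2 (not_lt.1 hn))

theorem ofWord_mem_iff {m q : ℕ} {w : ℕ → ℕ} (hm : 0 < m) (h0 : w 0 = 0) (hq : ∀ i < m, w i ≤ q)
    (h1 : ∀ i j, i + j < m → w (i + j) ≤ w i + w j)
    (h2 : ∀ i j, i < m → j < m → m ≤ i + j → w (i + j - m) ≤ w i + w j + 1) (x : ℕ) :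
    x ∈ (ofWord m q w hm h0 hq h1 h2).carrier ↔ w (x % m) ≤ x / m := Iff.rfl

theorem multiplicity_ofWord {m q : ℕ} {w : ℕ → ℕ} (hm : 0 < m) (h0 : w 0 = 0)
    (hq : ∀ i < m, w i ≤ q) (h1 : ∀ i j, i + j < m → w (i + j) ≤ w i + w j)
    (h2 : ∀ i j, i < m → j < m → m ≤ i + j → w (i + j - m) ≤ w i + w j + 1)
    (hpos : ∀ i < m, 0 < i → 0 < w i) :
    (ofWord m q w hm h0 hq h1 h2).multiplicity = m := by
  have hmem : m ∈ {x : ℕ | x ∈ (ofWord m q w hm h0 hq h1 h2).carrier ∧ x ≠ 0} := by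
    refine ⟨?_, hm.ne'⟩
    rw [ofWord_mem_iff, Nat.mod_self, h0]
    exact Nat.zero_le _
  refine le_antisymm (Nat.sInf_le hmem) (le_csInf ⟨m, hmem⟩ ?_)
  rintro x ⟨hx, hx0⟩
  by_contra hlt
  rw [ofWord_mem_iff, Nat.mod_eq_of_lt (not_le.1 hlt), Nat.div_eq_of_lt (not_le.1 hlt)] at hx
  have := hpos x (not_le.1 hlt) (Nat.pos_of_ne_zero hx0)
  omega

theorem frobenius_ofWord {m q r : ℕ} {w : ℕ → ℕ} (hm : 0 < m) (h0 : w 0 = 0)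
    (hq : ∀ i < m, w i ≤ q) (h1 : ∀ i j, i + j < m → w (i + j) ≤ w i + w j)
    (h2 : ∀ i j, i < m → j < m → m ≤ i + j → w (i + j - m) ≤ w i + w j + 1)
    (hrm : r < m) (hq0 : 0 < q) (hr : w r = q) (hgt : ∀ i, r < i → i < m → w i ≤ q - 1) :
    (ofWord m q w hm h0 hq h1 h2).frobenius = (((q - 1) * m + r : ℕ) : ℤ) := by
  have hc : (ofWord m q w hm h0 hq h1 h2).conductor = (q - 1) * m + r + 1 := by
    have hmem : (q - 1) * m + r + 1 ∈
        {c : ℕ | ∀ n : ℕ, c + n ∈ (ofWord m q w hm h0 hq h1 h2).carrier} := by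
      intro n
      rw [ofWord_mem_iff]
      set x := (q - 1) * m + r + 1 + n with hx
      have hxm := Nat.mod_lt x hm
      have hdm := Nat.div_add_mod' x m
      have hge : q - 1 ≤ x / m := (Nat.le_div_iff_mul_le hm).2 (by omega)
      rcases hge.eq_or_lt with he | hl
      · rw [← he] at hdm ⊢
        exact hgt _ (by omega) hxm
      · exact (hq _ hxm).trans (by omega)
    refine le_antisymm (Nat.sInf_le hmem) (le_csInf ⟨_, hmem⟩ ?_)
    intro c hcm
    by_contra hlt
    have := hcm ((q - 1) * m + r - c)
    rw [Nat.add_sub_cancel' (by omega), ofWord_mem_iff, mul_comm, Nat.mul_add_mod,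
      Nat.mod_eq_of_lt hrm, hr, mul_comm] at this
    have h3 : ((q - 1) * m + r) / m = q - 1 := by
      rw [mul_comm, Nat.mul_add_div hm, Nat.div_eq_of_lt hrm, add_zero]
    omega
  rw [frobenius, hc]
  push_cast
  ring

/-- Lower bounds for the entries of a large family of Kunz words. -/
def wordLower (q r m i : ℕ) : ℕ :=
  if i = 0 then 0 else if i ≤ r / 2 then (q + 1) / 2 else if i < r then q / 2
  else if i = r then q else if i ≤ (r + m) / 2 then q / 2 else q - 1 - q / 2

/-- Upper bounds for the entries of a large family of Kunz words. -/
def wordUpper (q r i : ℕ) : ℕ :=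
  if i = 0 then 0 else if i ≤ r then q else q - 1

/-- If `i + j ≤ r`, one index is at most `r / 2`, and the lower bounds add up to at least `⌈q/2⌉ +
⌊q/2⌋ = q`. Otherwise the target is `q - 1`, and `i + j < m` prevents both indices from exceeding
`(r + m) / 2`. -/
theorem wordUpper_add_le {q r m i j : ℕ} (hq : 3 ≤ q) (hi : 0 < i) (hj : 0 < j)
    (hij : i + j < m) : wordUpper q r (i + j) ≤ wordLower q r m i + wordLower q r m j := by
  unfold wordUpper wordLower
  split_ifs <;> omega

/-- The target is `q` only if `i + j ≤ r + m`, and then the indices are not both above `(r + m) /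
2`, so the lower bounds sum to at least `q - 1`. If both are above, the target is `q - 1`, and `2 (q
- 1 - ⌊q/2⌋) + 1` suffices. -/
theorem wordUpper_add_sub_le {q r m i j : ℕ} (hq : 3 ≤ q) (hi : i < m) (hj : j < m)
    (hij : m ≤ i + j) :
    wordUpper q r (i + j - m) ≤ wordLower q r m i + wordLower q r m j + 1 := by
  unfold wordUpper wordLower
  split_ifs <;> omega

theorem wordUpper_le (q r i : ℕ) : wordUpper q r i ≤ q := by
  unfold wordUpper
  split_ifs <;> omega

/-- This is where `q ≥ 3` is essential: for `q = 2` the bound `q - 1 - q / 2` is 0, and the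
multiplicity could drop below `m`. -/
theorem wordLower_pos {q r m i : ℕ} (hq : 3 ≤ q) (hi : 0 < i) : 0 < wordLower q r m i := by
  unfold wordLower
  split_ifs <;> omega

theorem card_piFinset_word_le_count {q r m : ℕ} (hq : 3 ≤ q) (hr : 0 < r) (hrm : r < m) :
    (Fintype.piFinset fun i : Fin m => Icc (wordLower q r m i) (wordUpper q r i)).card ≤
      count m ((q - 1) * m + r) := by
  have hm : 0 < m := by omega
  rw [← Set.ncard_coe_finset, count]
  -- `φ` reads off the Kunz word, so the box lies in the image under `φ` of the semigroups being
  -- counted.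
  let φ : NumericalSemigroup → Fin m → ℕ := fun Λ i => sInf {t | (i : ℕ) + t * m ∈ Λ.carrier}
  refine le_trans (Set.ncard_le_ncard (t := φ '' _) ?_
    ((finite_setOf_multiplicity_frobenius).image φ))
    (Set.ncard_image_le (finite_setOf_multiplicity_frobenius))
  intro v hv
  rw [mem_coe, Fintype.mem_piFinset] at hv
  set w : ℕ → ℕ := fun i => if h : i < m then v ⟨i, h⟩ else 0 with hw
  have hwv : ∀ i (h : i < m), w i = v ⟨i, h⟩ := fun i h => by simp [hw, h]
  have hlo : ∀ i < m, wordLower q r m i ≤ w i := fun i h => by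
    rw [hwv i h]; exact (mem_Icc.1 (hv ⟨i, h⟩)).1
  have hup : ∀ i < m, w i ≤ wordUpper q r i := fun i h => by
    rw [hwv i h]; exact (mem_Icc.1 (hv ⟨i, h⟩)).2
  have h0 : w 0 = 0 := by simpa [wordUpper] using hup 0 hm
  have hwq : ∀ i < m, w i ≤ q := fun i h => (hup i h).trans (wordUpper_le q r i)
  have h1 : ∀ i j, i + j < m → w (i + j) ≤ w i + w j := by
    intro i j hij
    rcases Nat.eq_zero_or_pos i with rfl | hi
    · simp
    rcases Nat.eq_zero_or_pos j with rfl | hj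
    · simp
    exact (hup _ hij).trans ((wordUpper_add_le hq hi hj hij).trans
      (Nat.add_le_add (hlo i (by omega)) (hlo j (by omega))))
  have h2 : ∀ i j, i < m → j < m → m ≤ i + j → w (i + j - m) ≤ w i + w j + 1 := by
    intro i j hi hj hij
    exact (hup _ (by omega)).trans ((wordUpper_add_sub_le hq hi hj hij).trans
      (Nat.add_le_add_right (Nat.add_le_add (hlo i hi) (hlo j hj)) 1))
  refine ⟨ofWord m q w hm h0 hwq h1 h2, ⟨?_, ?_⟩, ?_⟩
  · exact multiplicity_ofWord hm h0 hwq h1 h2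
      fun i hi hi0 => (wordLower_pos hq hi0).trans_le (hlo i hi)
  · refine frobenius_ofWord hm h0 hwq h1 h2 hrm (by omega) ?_ ?_
    · refine le_antisymm (hwq r hrm) (le_trans ?_ (hlo r hrm))
      unfold wordLower
      split_ifs <;> omega
    · intro i hi him
      refine (hup i him).trans ?_
      unfold wordUpper
      split_ifs <;> omega
  · funext i
    have hset : {t | (i : ℕ) + t * m ∈ (ofWord m q w hm h0 hwq h1 h2).carrier} =
        Set.Ici (w i) := by
      ext t
      rw [Set.mem_ofPred_eq, ofWord_mem_iff, Nat.add_mul_mod_self_right, Nat.mod_eq_of_lt i.2,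
        Nat.add_mul_div_right _ _ hm, Nat.div_eq_of_lt i.2, zero_add, Set.mem_Ici]
    simp only [φ]
    rw [hset, csInf_Ici, hwv i i.2]

theorem sq_div_four_eq (q : ℕ) : (q + 2) ^ 2 / 4 = (q / 2 + 1) * ((q + 1) / 2 + 1) := by
  obtain ⟨k, rfl | rfl⟩ := Nat.even_or_odd' q
  · have h1 : 2 * k / 2 = k := by omega
    have h2 : (2 * k + 1) / 2 = k := by omega
    have : (2 * k + 2) ^ 2 = 4 * ((k + 1) * (k + 1)) := by ring
    rw [h1, h2, this]
    omega
  · have h1 : (2 * k + 1) / 2 = k := by omega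
    have h2 : (2 * k + 1 + 1) / 2 = k + 1 := by omega
    have : (2 * k + 1 + 2) ^ 2 = 4 * ((k + 1) * (k + 1 + 1)) + 1 := by ring
    rw [h1, h2, this]
    omega

theorem pow_mul_pow_le_count {q r m : ℕ} (hq : 3 ≤ q) (hr : 0 < r) (hrm : r < m) :
    ((q + 2) ^ 2 / 4) ^ ((r - 1) / 2) * ((q - 1 + 2) ^ 2 / 4) ^ ((m - 1 - r) / 2) ≤
      count m ((q - 1) * m + r) := by
  refine le_trans ?_ (card_piFinset_word_le_count hq hr hrm)
  rw [Fintype.card_piFinset]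
  simp only [Nat.card_Icc]
  rw [Fin.prod_univ_eq_prod_range (fun i => wordUpper q r i + 1 - wordLower q r m i) m,
    range_eq_Ico]
  rw [← prod_Ico_consecutive _ (Nat.zero_le 1) (by omega : 1 ≤ m),
    ← prod_Ico_consecutive _ (by omega : 1 ≤ r / 2 + 1) (by omega : r / 2 + 1 ≤ m),
    ← prod_Ico_consecutive _ (by omega : r / 2 + 1 ≤ r) (by omega : r ≤ m),
    ← prod_Ico_consecutive _ (by omega : r ≤ r + 1) (by omega : r + 1 ≤ m),
    ← prod_Ico_consecutive _ (by omega : r + 1 ≤ (r + m) / 2 + 1) (by omega : (r + m) / 2 + 1 ≤ m)]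
  have hval : ∀ a b c : ℕ, (∀ i, a ≤ i → i < b → wordUpper q r i + 1 - wordLower q r m i = c) →
      ∏ i ∈ Ico a b, (wordUpper q r i + 1 - wordLower q r m i) = c ^ (b - a) := by
    intro a b c h
    rw [prod_congr rfl fun i hi => h i (mem_Ico.1 hi).1 (mem_Ico.1 hi).2, prod_const, Nat.card_Ico]
  -- On either side of `r` the two halves have interval sizes whose product is `c_q²`, respectively
  -- `c_{q-1}²`; the indices 0 and `r` are forced.
  rw [hval 0 1 1 (by intro i h1 h2; unfold wordUpper wordLower; split_ifs <;> omega),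
    hval 1 (r / 2 + 1) (q / 2 + 1)
      (by intro i h1 h2; unfold wordUpper wordLower; split_ifs <;> omega),
    hval (r / 2 + 1) r ((q + 1) / 2 + 1)
      (by intro i h1 h2; unfold wordUpper wordLower; split_ifs <;> omega),
    hval r (r + 1) 1 (by intro i h1 h2; unfold wordUpper wordLower; split_ifs <;> omega),
    hval (r + 1) ((r + m) / 2 + 1) ((q - 1) / 2 + 1)
      (by intro i h1 h2; unfold wordUpper wordLower; split_ifs <;> omega),
    hval ((r + m) / 2 + 1) m (q / 2 + 1)
      (by intro i h1 h2; unfold wordUpper wordLower; split_ifs <;> omega)]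
  rw [sq_div_four_eq q, sq_div_four_eq (q - 1), one_pow, one_pow, one_mul, one_mul, mul_pow,
    mul_pow, mul_assoc, show (q - 1 + 1) / 2 + 1 = q / 2 + 1 by omega]
  gcongr <;> omega

/-! ### Growth constants and the main term -/

theorem growthConst_sq (k : ℕ) : growthConst k ^ 2 = (((k + 2) ^ 2 / 4 : ℕ) : ℝ) :=
  Real.sq_sqrt (Nat.cast_nonneg _)

theorem one_le_growthConst (k : ℕ) : 1 ≤ growthConst k := by
  refine Real.one_le_sqrt.2 (Nat.one_le_cast.2 ?_)
  rw [sq_div_four_eq]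
  exact Nat.one_le_iff_ne_zero.2 (by positivity)

theorem growthConst_pos (k : ℕ) : 0 < growthConst k := one_pos.trans_le (one_le_growthConst k)

theorem growthConst_mono : Monotone growthConst := by
  intro a b hab
  refine Real.sqrt_le_sqrt (Nat.cast_le.2 (Nat.div_le_div_right ?_))
  exact Nat.pow_le_pow_left (by omega) 2

theorem growthConst_succ_le (k : ℕ) : growthConst (k + 1) ≤ 2 * growthConst k := by
  refine Real.sqrt_le_iff.2 ⟨by linarith [growthConst_pos k], ?_⟩
  rw [mul_pow, growthConst_sq, sq_div_four_eq, sq_div_four_eq]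
  have h1 : (k + 1) / 2 + 1 ≤ 2 * (k / 2 + 1) := by omega
  have h2 : (k + 1 + 1) / 2 + 1 ≤ 2 * ((k + 1) / 2 + 1) := by omega
  have := Nat.mul_le_mul h1 h2
  have h3 : 2 * (k / 2 + 1) * (2 * ((k + 1) / 2 + 1)) =
      2 ^ 2 * ((k / 2 + 1) * ((k + 1) / 2 + 1)) := by ring
  rw [h3] at this
  exact_mod_cast this

theorem growthConst_le (k : ℕ) : growthConst k ≤ k + 1 := by
  refine Real.sqrt_le_iff.2 ⟨by positivity, ?_⟩
  rw [sq_div_four_eq]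
  have h1 : k / 2 + 1 ≤ k + 1 := by omega
  have h2 : (k + 1) / 2 + 1 ≤ k + 1 ∨ k = 0 := by omega
  rcases h2 with h2 | rfl
  · have := Nat.mul_le_mul h1 h2
    rw [← sq] at this
    exact_mod_cast this
  · norm_num

theorem two_le_growthConst {k : ℕ} (hk : 2 ≤ k) : 2 ≤ growthConst k := by
  refine le_trans (Real.le_sqrt_of_sq_le ?_) (growthConst_mono hk)
  norm_num

/-- The main term: at `x = k m + ρ` with `ρ < m` it is `c_{k+1} ^ ρ * c_k ^ (m - ρ)`. -/
noncomputable def mainTerm (m x : ℕ) : ℝ :=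
  growthConst (x / m + 1) ^ (x % m) * growthConst (x / m) ^ (m - x % m)

theorem mainTerm_mul_add {m k ρ : ℕ} (hρ : ρ < m) :
    mainTerm m (k * m + ρ) = growthConst (k + 1) ^ ρ * growthConst k ^ (m - ρ) := by
  have hm : 0 < m := by omega
  have h1 : (k * m + ρ) / m = k := by
    rw [mul_comm, Nat.mul_add_div hm, Nat.div_eq_of_lt hρ, add_zero]
  have h2 : (k * m + ρ) % m = ρ := by
    rw [mul_comm, Nat.mul_add_mod, Nat.mod_eq_of_lt hρ]
  rw [mainTerm, h1, h2]

theorem mainTerm_pos (m x : ℕ) : 0 < mainTerm m x :=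
  mul_pos (pow_pos (growthConst_pos _) _) (pow_pos (growthConst_pos _) _)

/-- One step in `x` replaces one factor `c_k` by `c_{k+1}`, also when `x + 1` is a multiple of `m`.
Monotonicity and the growth bound of the main term follow. -/
theorem mainTerm_succ {m : ℕ} (hm : 0 < m) (x : ℕ) :
    ∃ P : ℝ, 0 < P ∧ mainTerm m x = P * growthConst (x / m) ∧
      mainTerm m (x + 1) = P * growthConst (x / m + 1) := by
  set k := x / m with hk
  set ρ := x % m with hρ
  have hlt : ρ < m := Nat.mod_lt x hm
  have hx : x = k * m + ρ := (Nat.div_add_mod' x m).symm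
  refine ⟨growthConst (k + 1) ^ ρ * growthConst k ^ (m - ρ - 1),
    mul_pos (pow_pos (growthConst_pos _) _) (pow_pos (growthConst_pos _) _), ?_, ?_⟩
  · rw [hx, mainTerm_mul_add hlt, mul_assoc, ← pow_succ]
    congr 2
    omega
  · rcases Nat.lt_or_ge (ρ + 1) m with h | h
    · rw [hx, add_assoc, mainTerm_mul_add h, pow_succ, Nat.sub_sub]
      ring
    · have hx1 : x + 1 = (k + 1) * m + 0 := by
        rw [Nat.succ_mul]
        omega
      rw [hx1, mainTerm_mul_add hm, pow_zero, one_mul, Nat.sub_zero,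
        show m - ρ - 1 = 0 by omega, pow_zero, mul_one, ← pow_succ]
      congr 1
      omega

theorem mainTerm_mono {m : ℕ} (hm : 0 < m) : Monotone (mainTerm m) := by
  refine monotone_nat_of_le_succ fun x => ?_
  obtain ⟨P, hP, h1, h2⟩ := mainTerm_succ hm x
  rw [h1, h2]
  exact mul_le_mul_of_nonneg_left (growthConst_mono (Nat.le_succ _)) hP.le

theorem mainTerm_add_le {m : ℕ} (hm : 0 < m) (x n : ℕ) :
    mainTerm m (x + n) ≤ 2 ^ n * mainTerm m x := by
  induction n with
  | zero => simp
  | succ n ih =>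
    obtain ⟨P, hP, h1, h2⟩ := mainTerm_succ hm (x + n)
    calc mainTerm m (x + n + 1) = P * growthConst ((x + n) / m + 1) := h2
      _ ≤ P * (2 * growthConst ((x + n) / m)) :=
          mul_le_mul_of_nonneg_left (growthConst_succ_le _) hP.le
      _ = 2 * mainTerm m (x + n) := by rw [h1]; ring
      _ ≤ 2 * (2 ^ n * mainTerm m x) := by linarith
      _ = _ := by ring

/-! ### Upper bound in terms of the main term -/

theorem card_reflectedWords_le_growthConst {d : ℕ} (hd0 : 0 < d) {p n L : ℕ} {D : Finset ℕ}
    (hD : D ∈ (Icc 1 L).powersetCard d) {Q : ℝ} (hQ : (p : ℝ) + 1 ≤ Q) :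
    ((reflectedWords p n D).card : ℝ) ≤
      Q ^ L * (Q ^ (1 / (d : ℝ))) ^ ((n + 1) / 2) * growthConst p ^ (n + 1) := by
  obtain ⟨hDs, hDc⟩ := mem_powersetCard.1 hD
  have hp : (0 : ℝ) ≤ p := Nat.cast_nonneg p
  refine (card_reflectedWords_le hd0 p n L D hDc fun e he => mem_Icc.1 (hDs he)).trans ?_
  rw [mul_pow, ← growthConst_sq, ← pow_mul, ← mul_assoc]
  have h1 : ((p : ℝ) + 1) ^ (1 / (d : ℝ)) ≤ Q ^ (1 / (d : ℝ)) :=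
    Real.rpow_le_rpow (by positivity) hQ (by positivity)
  have h2 : growthConst p ^ (2 * ((n + 1) / 2)) ≤ growthConst p ^ (n + 1) :=
    pow_le_pow_right₀ (one_le_growthConst p) (by omega)
  have h3 : (0 : ℝ) ≤ ((p : ℝ) + 1) ^ (1 / (d : ℝ)) := Real.rpow_nonneg (by positivity) _
  have h4 := (growthConst_pos p).le
  have h5 : 0 ≤ Q := by linarith
  gcongr

theorem card_gapSets_le_mainTerm {m f q J : ℕ} (hJ : 0 < J) (hm : J * (J + 1) ≤ m)
    (hf : f < q * m) :
    ((gapSets m f).card : ℝ) ≤ ((2 * J * q : ℕ) : ℝ) *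
      ((q : ℝ) * m + 2) ^ (J + J * (2 * J * q)) * ((q : ℝ) + 2) ^ (3 * (m / J) + 2) *
      (((q : ℝ) + 2) ^ (1 / (J : ℝ))) ^ (m + 1) * mainTerm m f := by
  -- With `d = J` there are O(`J q`) windows. In the exponent `3 L + 2` below, each of the two words
  -- costs `L`, moving from the cut to `f` costs another `L`, and the 2 pays for one surplus growth
  -- constant per word.
  set L := m / J with hL
  have hJL : J < L := by
    rw [hL, ← Nat.succ_le_iff, Nat.le_div_iff_mul_le hJ]
    simpa [mul_comm] using hm
  have hLm : L ≤ m := Nat.div_le_self _ _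
  have hm0 : 0 < m := by omega
  have hq0 : 0 < q := by
    rcases Nat.eq_zero_or_pos q with rfl | h
    · omega
    · exact h
  set Q : ℝ := (q : ℝ) + 2 with hQ
  have hQ2 : 2 ≤ Q := by rw [hQ]; linarith [(Nat.cast_nonneg q : (0 : ℝ) ≤ q)]
  have hQr : 1 ≤ Q ^ (1 / (J : ℝ)) := Real.one_le_rpow (by linarith) (by positivity)
  have hX : ∀ k ρ : ℕ, ρ < m → k * m + ρ ≤ f + L → ∀ D ∈ (Icc 1 L).powersetCard J,
      ((reflectedWords (k + 1) ρ D).card : ℝ) * (reflectedWords k (m - ρ) D).card ≤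
        Q ^ (3 * L + 2) * (Q ^ (1 / (J : ℝ))) ^ (m + 1) * mainTerm m f := by
    intro k ρ hρ hk D hD
    have hkq : k ≤ q := by
      have : k * m < (q + 1) * m := by rw [Nat.succ_mul]; omega
      exact Nat.lt_succ_iff.1 (Nat.lt_of_mul_lt_mul_right this)
    have hkR : (k : ℝ) ≤ q := Nat.cast_le.2 hkq
    have h1 := card_reflectedWords_le_growthConst (n := ρ) (p := k + 1) (Q := Q) hJ hD
      (by push_cast; linarith)
    have h2 := card_reflectedWords_le_growthConst (n := m - ρ) (p := k) (Q := Q) hJ hD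
      (by linarith)
    have hg1 : growthConst (k + 1) ≤ Q := (growthConst_le _).trans (by push_cast; linarith)
    have hg2 : growthConst k ≤ Q := (growthConst_le _).trans (by linarith)
    have hgp1 := (growthConst_pos (k + 1)).le
    have hgp2 := (growthConst_pos k).le
    have hmt : mainTerm m (k * m + ρ) ≤ Q ^ L * mainTerm m f :=
      (mainTerm_mono hm0 hk).trans ((mainTerm_add_le hm0 f L).trans
        (mul_le_mul_of_nonneg_right (pow_le_pow_left₀ (by norm_num) hQ2 L) (mainTerm_pos m f).le))
    set R := Q ^ (1 / (J : ℝ)) with hR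
    have hpow : R ^ ((ρ + 1) / 2 + (m - ρ + 1) / 2) ≤ R ^ (m + 1) :=
      pow_le_pow_right₀ hQr (by omega)
    calc _ ≤ (Q ^ L * R ^ ((ρ + 1) / 2) * growthConst (k + 1) ^ (ρ + 1)) *
          (Q ^ L * R ^ ((m - ρ + 1) / 2) * growthConst k ^ (m - ρ + 1)) :=
          mul_le_mul h1 h2 (by positivity) (by positivity)
      _ = Q ^ L * Q ^ L * R ^ ((ρ + 1) / 2 + (m - ρ + 1) / 2) *
          (growthConst (k + 1) * growthConst k) * mainTerm m (k * m + ρ) := by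
          rw [mainTerm_mul_add hρ]
          ring
      _ ≤ Q ^ L * Q ^ L * R ^ (m + 1) * (Q * Q) * (Q ^ L * mainTerm m f) := by
          have := (mainTerm_pos m (k * m + ρ)).le
          gcongr
      _ = _ := by ring
  have main := card_gapSets_le hJL hLm hJ hX
  have hfL : f / L + 1 ≤ 2 * J * q := by
    rw [Nat.succ_le_iff, Nat.div_lt_iff_lt_mul (by omega)]
    refine hf.trans_le ?_
    have h1 : m < J * L + J := by
      have := Nat.lt_mul_div_succ m hJ
      rwa [mul_add, mul_one] at this
    have h2 : J ≤ J * L := Nat.le_mul_of_pos_right _ (by omega)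
    calc q * m ≤ q * (2 * (J * L)) := Nat.mul_le_mul_left _ (by omega)
      _ = _ := by ring
  refine main.trans ?_
  have hb1 : (L : ℝ) + 1 ≤ (q : ℝ) * m + 2 := by
    have : L + 1 ≤ q * m + 2 := by
      have := Nat.le_mul_of_pos_left m hq0
      omega
    exact_mod_cast this
  have hb2 : (f : ℝ) + 2 ≤ (q : ℝ) * m + 2 := by
    have : f + 2 ≤ q * m + 2 := by omega
    exact_mod_cast this
  have hb3 : (1 : ℝ) ≤ (q : ℝ) * m + 2 := by
    have : (0 : ℝ) ≤ (q : ℝ) * m := by positivity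
    linarith
  have hmt := (mainTerm_pos m f).le
  have hbp : ((f : ℝ) + 2) ^ (J * (f / L + 1)) ≤ ((q : ℝ) * m + 2) ^ (J * (2 * J * q)) :=
    (pow_le_pow_left₀ (by positivity) hb2 _).trans
      (pow_le_pow_right₀ hb3 (Nat.mul_le_mul_left _ hfL))
  have hbq : ((L : ℝ) + 1) ^ J ≤ ((q : ℝ) * m + 2) ^ J := pow_le_pow_left₀ (by positivity) hb1 _
  calc _ ≤ ((2 * J * q : ℕ) : ℝ) * ((q : ℝ) * m + 2) ^ J *
        ((q : ℝ) * m + 2) ^ (J * (2 * J * q)) *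
        (Q ^ (3 * L + 2) * (Q ^ (1 / (J : ℝ))) ^ (m + 1) * mainTerm m f) := by
        gcongr
    _ = _ := by
        rw [pow_add _ J]
        ring

/-! ### Comparison of logarithms -/

theorem mainTerm_le_mul_count {q r m : ℕ} (hq : 3 ≤ q) (hr : 0 < r) (hrm : r < m) :
    mainTerm m ((q - 1) * m + r) ≤
      growthConst q ^ 2 * growthConst (q - 1) ^ 2 * count m ((q - 1) * m + r) := by
  have h := pow_mul_pow_le_count hq hr hrm
  have h' : ((growthConst q ^ 2) ^ ((r - 1) / 2)) *
      ((growthConst (q - 1) ^ 2) ^ ((m - 1 - r) / 2)) ≤ (count m ((q - 1) * m + r) : ℝ) := by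
    rw [growthConst_sq, growthConst_sq]
    exact_mod_cast h
  have h0 := (growthConst_pos q).le
  have h1 := (growthConst_pos (q - 1)).le
  rw [mainTerm_mul_add hrm, Nat.sub_add_cancel (by omega)]
  calc _ ≤ growthConst q ^ (2 + 2 * ((r - 1) / 2)) *
        growthConst (q - 1) ^ (2 + 2 * ((m - 1 - r) / 2)) := by
        refine mul_le_mul (pow_le_pow_right₀ (one_le_growthConst _) (by omega))
          (pow_le_pow_right₀ (one_le_growthConst _) (by omega)) (by positivity) (by positivity)
    _ = growthConst q ^ 2 * growthConst (q - 1) ^ 2 * (((growthConst q ^ 2) ^ ((r - 1) / 2)) *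
      ((growthConst (q - 1) ^ 2) ^ ((m - 1 - r) / 2))) := by
        rw [pow_add, pow_add, pow_mul, pow_mul]
        ring
    _ ≤ _ := mul_le_mul_of_nonneg_left h' (by positivity)

theorem count_pos {q r m : ℕ} (hq : 3 ≤ q) (hr : 0 < r) (hrm : r < m) :
    0 < count m ((q - 1) * m + r) := by
  refine lt_of_lt_of_le ?_ (pow_mul_pow_le_count hq hr hrm)
  rw [sq_div_four_eq, sq_div_four_eq]
  positivity

theorem log_count_le {m f q J : ℕ} (hJ : 0 < J) (hm : J * (J + 1) ≤ m) (hf : f < q * m)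
    (hc : 0 < count m f) :
    Real.log (count m f) ≤ Real.log (mainTerm m f) +
      (Real.log ((2 * J * q : ℕ) : ℝ) + 3 * Real.log ((q : ℝ) + 2)) +
      ((J + J * (2 * J * q) : ℕ) : ℝ) * Real.log ((q : ℝ) * m + 2) +
      4 * Real.log ((q : ℝ) + 2) / J * m := by
  have hq0 : 0 < q := by
    rcases Nat.eq_zero_or_pos q with rfl | h
    · omega
    · exact h
  have hJR : (0 : ℝ) < J := Nat.cast_pos.2 hJ
  have hJ1 : (1 : ℝ) ≤ J := Nat.one_le_cast.2 hJ
  have hB : (0 : ℝ) < ((2 * J * q : ℕ) : ℝ) := Nat.cast_pos.2 (by positivity)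
  have hx : (0 : ℝ) < (q : ℝ) * m + 2 := by positivity
  have hQ : (0 : ℝ) < (q : ℝ) + 2 := by positivity
  have hlQ : 0 ≤ Real.log ((q : ℝ) + 2) :=
    Real.log_nonneg (by linarith [(Nat.cast_nonneg q : (0 : ℝ) ≤ q)])
  have hR : (0 : ℝ) < ((q : ℝ) + 2) ^ (1 / (J : ℝ)) := Real.rpow_pos_of_pos hQ _
  have hM := mainTerm_pos m f
  have h := Real.log_le_log (Nat.cast_pos.2 hc)
    ((Nat.cast_le.2 count_le_card_gapSets).trans (card_gapSets_le_mainTerm hJ hm hf))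
  rw [Real.log_mul (by positivity) hM.ne', Real.log_mul (by positivity) (by positivity),
    Real.log_mul (by positivity) (by positivity), Real.log_mul hB.ne' (by positivity),
    Real.log_pow, Real.log_pow, Real.log_pow, Real.log_rpow hQ] at h
  have h1 : ((3 * (m / J) + 2 : ℕ) : ℝ) * Real.log ((q : ℝ) + 2) ≤
      (3 * ((m : ℝ) / J) + 2) * Real.log ((q : ℝ) + 2) := by
    refine mul_le_mul_of_nonneg_right ?_ hlQ
    push_cast
    linarith [(Nat.cast_div_le : ((m / J : ℕ) : ℝ) ≤ (m : ℝ) / J)]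
  have h2 : ((m + 1 : ℕ) : ℝ) * (1 / (J : ℝ) * Real.log ((q : ℝ) + 2)) ≤
      ((m : ℝ) / J + 1) * Real.log ((q : ℝ) + 2) := by
    rw [← mul_assoc]
    refine mul_le_mul_of_nonneg_right ?_ hlQ
    push_cast
    rw [add_mul, one_mul, mul_one_div]
    have : 1 / (J : ℝ) ≤ 1 := by rw [div_le_one hJR]; exact hJ1
    linarith
  have h3 : 4 * Real.log ((q : ℝ) + 2) / J * m = 4 * ((m : ℝ) / J) * Real.log ((q : ℝ) + 2) := by
    ring
  rw [h3]
  linarith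

theorem exists_forall_const_add_log_le {q : ℕ} (hq : 1 ≤ q) (K₁ : ℝ) {K₂ : ℝ} (hK : 0 ≤ K₂)
    {ε : ℝ} (hε : 0 < ε) :
    ∃ M : ℕ, ∀ m : ℕ, M ≤ m → K₁ + K₂ * Real.log ((q : ℝ) * m + 2) ≤ ε * m := by
  obtain ⟨A, hA⟩ := Filter.eventually_atTop.1 (Real.isLittleO_log_id_atTop.bound
    (show 0 < ε / (2 * ((K₂ + 1) * (q + 2))) by positivity))
  have htend := tendsto_natCast_atTop_atTop (R := ℝ)
  obtain ⟨M, hM⟩ := Filter.eventually_atTop.1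
    ((htend.eventually_ge_atTop (2 * K₁ / ε)).and
      ((htend.eventually_ge_atTop A).and (Filter.eventually_ge_atTop 1)))
  refine ⟨M, fun m hm => ?_⟩
  obtain ⟨h1, h2, h3⟩ := hM m hm
  have hmR : (1 : ℝ) ≤ m := Nat.one_le_cast.2 h3
  have hqR : (1 : ℝ) ≤ q := Nat.one_le_cast.2 hq
  have hqm : (m : ℝ) ≤ q * m := le_mul_of_one_le_left (by linarith) hqR
  have hK1 : K₁ ≤ ε / 2 * m := by
    rw [div_le_iff₀ hε] at h1
    linarith
  have hb := hA ((q : ℝ) * m + 2) (by linarith)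
  rw [id, Real.norm_of_nonneg (Real.log_nonneg (by linarith)),
    Real.norm_of_nonneg (by linarith)] at hb
  have hK2 : K₂ * Real.log ((q : ℝ) * m + 2) ≤ ε / 2 * m := by
    calc K₂ * Real.log ((q : ℝ) * m + 2)
        ≤ (K₂ + 1) * Real.log ((q : ℝ) * m + 2) :=
          mul_le_mul_of_nonneg_right (by linarith) (Real.log_nonneg (by linarith))
      _ ≤ (K₂ + 1) * (ε / (2 * ((K₂ + 1) * (q + 2))) * (((q : ℝ) + 2) * m)) := by
          refine mul_le_mul_of_nonneg_left (hb.trans ?_) (by linarith)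
          refine mul_le_mul_of_nonneg_left ?_ (by positivity)
          linarith
      _ = ε / 2 * m := by
          have : K₂ + 1 ≠ 0 := by positivity
          have : (q : ℝ) + 2 ≠ 0 := by positivity
          field_simp
  linarith

theorem exists_forall_abs_log_count_sub_le {q : ℕ} (hq : 3 ≤ q) {ε : ℝ} (hε : 0 < ε) :
    ∃ M : ℕ, ∀ r m : ℕ, M ≤ m → 0 < r → r < m →
      |Real.log (count m ((q - 1) * m + r)) - Real.log (mainTerm m ((q - 1) * m + r))| ≤
        ε * m := by
  set ℓ := Real.log ((q : ℝ) + 2) with hℓ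
  -- `J` makes the linear error `4 ℓ / J` at most `ε / 2`; with `J` fixed, the other errors are
  -- O(log m) and take the remaining `ε / 2`.
  obtain ⟨J, hJ⟩ := exists_nat_ge (8 * ℓ / ε + 1)
  have hℓ0 : 0 ≤ ℓ := Real.log_nonneg (by linarith [(Nat.cast_nonneg q : (0 : ℝ) ≤ q)])
  have hJR : (0 : ℝ) < J := by
    have : 0 ≤ 8 * ℓ / ε := by positivity
    linarith
  have hJ0 : 0 < J := Nat.cast_pos.1 hJR
  have hJℓ : 4 * ℓ / J ≤ ε / 2 := by
    rw [div_le_iff₀ hJR]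
    have : 8 * ℓ / ε ≤ J := by linarith
    rw [div_le_iff₀ hε] at this
    linarith
  obtain ⟨M₁, hM₁⟩ := exists_forall_const_add_log_le (by omega : 1 ≤ q)
    (Real.log ((2 * J * q : ℕ) : ℝ) + 3 * ℓ)
    (Nat.cast_nonneg (J + J * (2 * J * q)) : (0 : ℝ) ≤ ((J + J * (2 * J * q) : ℕ) : ℝ))
    (half_pos hε)
  obtain ⟨M₂, hM₂⟩ := exists_nat_ge
    (Real.log (growthConst q ^ 2 * growthConst (q - 1) ^ 2) / ε)
  refine ⟨max (J * (J + 1)) (max M₁ M₂), fun r m hm hr hrm => ?_⟩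
  rw [max_le_iff, max_le_iff] at hm
  obtain ⟨hm1, hm2, hm3⟩ := hm
  have hc := count_pos hq hr hrm
  have hcR : (0 : ℝ) < count m ((q - 1) * m + r) := Nat.cast_pos.2 hc
  have hf : (q - 1) * m + r < q * m := by
    obtain ⟨k, rfl⟩ : ∃ k, q = k + 1 := ⟨q - 1, by omega⟩
    rw [Nat.succ_mul, Nat.add_sub_cancel]
    omega
  have hG : 0 < growthConst q ^ 2 * growthConst (q - 1) ^ 2 :=
    mul_pos (pow_pos (growthConst_pos _) _) (pow_pos (growthConst_pos _) _)
  rw [abs_sub_le_iff]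
  constructor
  · have h1 := log_count_le hJ0 hm1 hf hc
    have h2 := hM₁ m hm2
    have h3 : 4 * ℓ / J * m ≤ ε / 2 * m := mul_le_mul_of_nonneg_right hJℓ (Nat.cast_nonneg m)
    linarith
  · have h1 := Real.log_le_log (mainTerm_pos _ _) (mainTerm_le_mul_count hq hr hrm)
    rw [Real.log_mul hG.ne' hcR.ne'] at h1
    have h2 : (M₂ : ℝ) ≤ m := Nat.cast_le.2 hm3
    have h3 := hM₂.trans h2
    rw [div_le_iff₀ hε] at h3
    linarith

/-- The `m`-th power of the base `c_q ^ α * c_{q-1} ^ (1 - α)` is the main term. -/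
theorem log_growthConst_rpow_mul {q r m : ℕ} (hq : 1 ≤ q) (hrm : r < m) :
    Real.log (growthConst q ^ ((((q - 1) * m + r : ℕ) : ℝ) / m - ((q : ℝ) - 1)) *
      growthConst (q - 1) ^ (1 - ((((q - 1) * m + r : ℕ) : ℝ) / m - ((q : ℝ) - 1)))) * m =
      Real.log (mainTerm m ((q - 1) * m + r)) := by
  have hm : (0 : ℝ) < m := Nat.cast_pos.2 (by omega)
  have hα : (((q - 1) * m + r : ℕ) : ℝ) / m - ((q : ℝ) - 1) = r / m := by
    rw [Nat.cast_add, Nat.cast_mul, Nat.cast_sub hq, Nat.cast_one]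
    field_simp
    ring
  have h1 := growthConst_pos q
  have h2 := growthConst_pos (q - 1)
  rw [hα, mainTerm_mul_add hrm, Nat.sub_add_cancel hq,
    Real.log_mul (Real.rpow_pos_of_pos h1 _).ne' (Real.rpow_pos_of_pos h2 _).ne',
    Real.log_mul (by positivity) (by positivity), Real.log_rpow h1, Real.log_rpow h2,
    Real.log_pow, Real.log_pow, Nat.cast_sub hrm.le]
  field_simp

/-- Keeps the logarithm of the base at least log 2, so that an error in the logarithm of the count
can be turned into an error in the exponent, uniformly in `f`. -/
theorem two_pow_le_mainTerm {q r m : ℕ} (hq : 3 ≤ q) (hrm : r < m) :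
    2 ^ m ≤ mainTerm m ((q - 1) * m + r) := by
  rw [mainTerm_mul_add hrm, Nat.sub_add_cancel (by omega)]
  calc (2 : ℝ) ^ m = 2 ^ r * 2 ^ (m - r) := by
        rw [← pow_add, Nat.add_sub_cancel' hrm.le]
    _ ≤ _ := mul_le_mul (pow_le_pow_left₀ (by norm_num) (two_le_growthConst (by omega)) _)
        (pow_le_pow_left₀ (by norm_num) (two_le_growthConst (by omega)) _) (by positivity)
        (pow_nonneg (growthConst_pos _).le _)

end NumericalSemigroup

end

/-! ### The theorem -/

open NumericalSemigroup in
theorem mainTheorem1 (q : ℕ) (hq : 3 ≤ q) :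
    ∃ E : ℕ → ℕ → ℝ,
      (∀ f m : ℕ, (q - 1) * m < f → f < q * m →
        (NumericalSemigroup.count m f : ℝ) =
          (NumericalSemigroup.growthConst q ^ ((f : ℝ) / (m : ℝ) - ((q : ℝ) - 1)) *
            NumericalSemigroup.growthConst (q - 1) ^
              (1 - ((f : ℝ) / (m : ℝ) - ((q : ℝ) - 1)))) ^ ((m : ℝ) + E f m)) ∧
      ∀ ε : ℝ, 0 < ε → ∃ M : ℕ, ∀ f m : ℕ, M ≤ m → (q - 1) * m < f → f < q * m →
        |E f m| ≤ ε * (m : ℝ) := by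
  set b : ℕ → ℕ → ℝ := fun f m => growthConst q ^ ((f : ℝ) / (m : ℝ) - ((q : ℝ) - 1)) *
    growthConst (q - 1) ^ (1 - ((f : ℝ) / (m : ℝ) - ((q : ℝ) - 1))) with hb
  have hdecomp : ∀ f m : ℕ, (q - 1) * m < f → f < q * m →
      ∃ r, f = (q - 1) * m + r ∧ 0 < r ∧ r < m := by
    intro f m h1 h2
    obtain ⟨k, rfl⟩ : ∃ k, q = k + 1 := ⟨q - 1, by omega⟩
    rw [Nat.succ_mul] at h2
    rw [Nat.add_sub_cancel] at h1 ⊢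
    exact ⟨f - k * m, by omega, by omega, by omega⟩
  have hbpos : ∀ f m, 0 < b f m := fun f m =>
    mul_pos (Real.rpow_pos_of_pos (growthConst_pos _) _)
      (Real.rpow_pos_of_pos (growthConst_pos _) _)
  have hlog : ∀ r m : ℕ, r < m → Real.log (b ((q - 1) * m + r) m) * m =
      Real.log (mainTerm m ((q - 1) * m + r)) := fun r m hrm =>
    log_growthConst_rpow_mul (by omega) hrm
  have hlog2 : ∀ r m : ℕ, r < m → Real.log 2 ≤ Real.log (b ((q - 1) * m + r) m) := by
    intro r m hrm
    have hm : (0 : ℝ) < m := Nat.cast_pos.2 (by omega)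
    have h := Real.log_le_log (by positivity) (two_pow_le_mainTerm hq hrm)
    rw [← hlog r m hrm, Real.log_pow, mul_comm] at h
    exact le_of_mul_le_mul_right h hm
  have hl2 : 0 < Real.log 2 := Real.log_pos one_lt_two
  -- `E` is forced by the identity. It equals the difference of logarithms divided by log b, and `ε
  -- log 2` is the precision that leaves `ε m` after this division.
  refine ⟨fun f m => Real.logb (b f m) (count m f) - m, ?_, ?_⟩
  · intro f m h1 h2
    obtain ⟨r, rfl, hr, hrm⟩ := hdecomp f m h1 h2
    have hne : b ((q - 1) * m + r) m ≠ 1 := by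
      intro h
      have := hlog2 r m hrm
      rw [h, Real.log_one] at this
      linarith
    change _ = b ((q - 1) * m + r) m ^ _
    rw [add_sub_cancel, Real.rpow_logb (hbpos _ _) hne (Nat.cast_pos.2 (count_pos hq hr hrm))]
  · intro ε hε
    obtain ⟨M, hM⟩ := exists_forall_abs_log_count_sub_le hq (mul_pos hε hl2)
    refine ⟨M, fun f m hm h1 h2 => ?_⟩
    obtain ⟨r, rfl, hr, hrm⟩ := hdecomp f m h1 h2
    have hB := hlog2 r m hrm
    have hB0 : 0 < Real.log (b ((q - 1) * m + r) m) := hl2.trans_le hB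
    have h := hM r m hm hr hrm
    rw [← hlog r m hrm] at h
    have heq : Real.logb (b ((q - 1) * m + r) m) (count m ((q - 1) * m + r)) - m =
        (Real.log (count m ((q - 1) * m + r)) - Real.log (b ((q - 1) * m + r) m) * m) /
          Real.log (b ((q - 1) * m + r) m) := by
      rw [Real.logb]
      field_simp
    simp only [heq]
    rw [abs_div, abs_of_pos hB0, div_le_iff₀ hB0]
    refine h.trans ?_
    rw [mul_assoc, mul_assoc]
    refine mul_le_mul_of_nonneg_left ?_ hε.le
    rw [mul_comm]
    exact mul_le_mul_of_nonneg_left hB (Nat.cast_nonneg m)
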